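/- Conventions. A *dimension group* is a directed, unperforated partially ordered abelian group with the Riesz interpolation property. An *order unit* of a partially ordered abelian group $G$ is an element $u\ge 0$ such that every $x\in G$ satisfies $x\le nu$ for some $n\in\mathbb N$. An *order ideal* is a convex directed subgroup, and $G$ is *simple* if it has no order ideals other than $0$ and $G$. If $G$ has an order unit, its *simplification* $G^s$ is the same abelian group with positive cone consisting of $0$ and the order units of $G$. For an order unit $u$, $S(G,u)$ is the convex set of positive group homomorphisms $\tau:G\to\mathbb R$ with $\tau(u)=1$, and the *pure traces* are its extreme points (up to rescaling they do not depend on $u$). A dimension group with order unit is *approximately divisible* if $\tau(G)$ is dense in $\mathbb R$ for every pure trace $\tau$. *Direct limits* are limits of partially ordered abelian groups, over directed sets, along positive group homomorphisms. A dimension group is *pro-finite-dimensional* if it is a direct limit of approximately divisible dimension groups $G_\alpha$ with order units $u_\alpha$, each with finitely many pure traces, along positive homomorphisms $\phi_{\alpha,\beta}:G_\alpha\to G_\beta$ such that each $\phi_{\alpha,\beta}(u_\alpha)$ is an order unit of $G_\beta$. Statement. Let $p>1$ be an integer and let $G$ be a $p$-divisible dimension group (every $x\in G$ is of the form $py$ with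 $y\in G$). 1. If $G$ has an order unit, then its simplification $G^s$ is a direct limit of simple dimension groups, each with finitely many pure traces. 2. If $G$ is simple, then $G$ is a direct limit of simple dimension groups, each with finitely many pure traces, and $G$ is pro-finite-dimensional. -/

import Mathlib

universe u

namespace OrderedGroup

section Basic

variable (G : Type*) [AddCommGroup G] [PartialOrder G]

/-- A partially ordered abelian group is unperforated if `n • x ≥ 0` with `n > 0` forces `x ≥ 0`. -/
def IsUnperforated : Prop :=
  ∀ (n : ℕ) (x : G), 0 < n → 0 ≤ n • x → 0 ≤ x

/-- The Riesz interpolation property: whenever `a₁, a₂ ≤ b₁, b₂` there is some `c` in between. -/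
def HasRieszInterpolation : Prop :=
  ∀ a₁ a₂ b₁ b₂ : G, a₁ ≤ b₁ → a₁ ≤ b₂ → a₂ ≤ b₁ → a₂ ≤ b₂ →
    ∃ c : G, a₁ ≤ c ∧ a₂ ≤ c ∧ c ≤ b₁ ∧ c ≤ b₂

/-- A dimension group is a directed, unperforated partially ordered abelian group with the
Riesz interpolation property. -/
structure IsDimensionGroup : Prop where
  directed : IsDirectedOrder G
  unperforated : IsUnperforated G
  interpolation : HasRieszInterpolation G

variable {G}

/-- An order unit is a positive element such that every element lies below a multiple of it. -/
def IsOrderUnit (v : G) : Prop :=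
  0 ≤ v ∧ ∀ x : G, ∃ n : ℕ, x ≤ n • v

/-- An order ideal is a subgroup that is convex and directed. -/
def IsOrderIdeal (H : AddSubgroup G) : Prop :=
  (H : Set G).OrdConnected ∧ DirectedOn (· ≤ ·) (H : Set G)

variable (G)

/-- A partially ordered abelian group is simple if it has no order ideals but `0` and itself. -/
def IsSimple : Prop :=
  ∀ H : AddSubgroup G, IsOrderIdeal H → H = ⊥ ∨ H = ⊤

variable {G}

/-- `S(G, v)`: the traces normalized at `v`, that is, the positive group homomorphisms
`τ : G → ℝ` with `τ v = 1`. It is a convex subset of the real vector space of all group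
homomorphisms from `G` to `ℝ`. -/
def traceSpace (v : G) : Set (G →+ ℝ) :=
  {τ | (∀ x : G, 0 ≤ x → 0 ≤ τ x) ∧ τ v = 1}

/-- The pure traces of `(G, v)`: the extreme points of `S(G, v)`. -/
def pureTraces (v : G) : Set (G →+ ℝ) :=
  Set.extremePoints ℝ (traceSpace v)

variable (G)

/-- `G` has an order unit and, for every order unit `v`, only finitely many pure traces normalized
at `v`. (A change of order unit only rescales the pure traces, so that their number does not depend
on the order unit.) -/
def HasFinitelyManyPureTraces : Prop :=
  (∃ v : G, IsOrderUnit v) ∧ ∀ v : G, IsOrderUnit v → (pureTraces v).Finite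

/-- `G` has an order unit, and every pure trace has dense range in `ℝ` (this does not depend on the
order unit at which the traces are normalized). -/
def IsApproximatelyDivisible : Prop :=
  (∃ v : G, IsOrderUnit v) ∧
    ∀ v : G, IsOrderUnit v → ∀ τ ∈ pureTraces v, Dense (Set.range τ)

end Basic

section Simplification

variable {G : Type*} [AddCommGroup G] [PartialOrder G] [IsOrderedAddMonoid G]

theorem IsOrderUnit.add {v w : G} (hv : IsOrderUnit v) (hw : IsOrderUnit w) :
    IsOrderUnit (v + w) := by
  refine ⟨add_nonneg hv.1 hw.1, fun x => ?_⟩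
  obtain ⟨n, hn⟩ := hv.2 x
  refine ⟨n, hn.trans ?_⟩
  rw [nsmul_add]
  exact le_add_of_nonneg_right (nsmul_nonneg hw.1 n)

/-- The underlying group of the simplification `Gˢ` of `G`; the order is given below. -/
def Simplification (G : Type*) : Type _ := G

namespace Simplification

instance : AddCommGroup (Simplification G) := inferInstanceAs (AddCommGroup G)

variable (G)

/-- The identity map from `G` to its simplification, as an isomorphism of groups. -/
def equiv : G ≃+ Simplification G := AddEquiv.refl G

variable {G}

/-- The order of the simplification: `x ≤ y` if and only if `y - x` is zero or an order unit
of `G`. -/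
instance : PartialOrder (Simplification G) where
  le x y := x = y ∨ IsOrderUnit ((equiv G).symm (y - x))
  le_refl x := Or.inl rfl
  le_trans x y z hxy hyz := by
    rcases hxy with rfl | hxy
    · exact hyz
    · rcases hyz with rfl | hyz
      · exact Or.inr hxy
      · refine Or.inr ?_
        have h := hyz.add hxy
        rwa [← map_add, sub_add_sub_cancel] at h
  le_antisymm x y hxy hyx := by
    rcases hxy with rfl | hxy
    · rfl
    · rcases hyx with rfl | hyx
      · rfl
      · have h₁ := hxy.1
        have h₂ := hyx.1
        rw [map_sub, sub_nonneg] at h₁ h₂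
        exact (equiv G).symm.injective (le_antisymm h₁ h₂)

instance : IsOrderedAddMonoid (Simplification G) where
  add_le_add_left x y hxy z := by
    rcases hxy with rfl | hxy
    · exact le_rfl
    · refine Or.inr ?_
      rwa [add_sub_add_right_eq_sub]

/-- The positive cone of the simplification consists of `0` and the order units of `G`. -/
theorem nonneg_iff (x : G) : 0 ≤ equiv G x ↔ x = 0 ∨ IsOrderUnit x := by
  change 0 = equiv G x ∨ IsOrderUnit ((equiv G).symm (equiv G x - 0)) ↔ _
  rw [sub_zero, AddEquiv.symm_apply_apply, eq_comm, map_eq_zero_iff _ (equiv G).injective]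

end Simplification

end Simplification

/-- A directed system of partially ordered abelian groups and positive group homomorphisms. -/
structure PosSystem : Type (u + 1) where
  /-- the index set -/
  Index : Type u
  [preorderIndex : Preorder Index]
  [directedIndex : IsDirectedOrder Index]
  [nonemptyIndex : Nonempty Index]
  /-- the partially ordered abelian groups -/
  obj : Index → Type u
  [addCommGroup : ∀ i, AddCommGroup (obj i)]
  [partialOrder : ∀ i, PartialOrder (obj i)]
  [isOrderedAddMonoid : ∀ i, IsOrderedAddMonoid (obj i)]
  /-- the connecting maps -/
  map : ∀ i j, i ≤ j → obj i →+ obj j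
  map_nonneg : ∀ i j (h : i ≤ j) (x : obj i), 0 ≤ x → 0 ≤ map i j h x
  map_self : ∀ i (h : i ≤ i) (x : obj i), map i i h x = x
  map_map : ∀ i j k (hij : i ≤ j) (hjk : j ≤ k) (x : obj i),
    map j k hjk (map i j hij x) = map i k (hij.trans hjk) x

namespace PosSystem

attribute [instance] preorderIndex directedIndex nonemptyIndex addCommGroup partialOrder
  isOrderedAddMonoid

/-- The direct limit of the underlying abelian groups. -/
abbrev Limit (S : PosSystem.{u}) : Type u :=
  letI := Classical.decEq S.Index
  AddCommGroup.DirectLimit S.obj S.map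

/-- The canonical map from a group of the system to the direct limit. -/
noncomputable def toLimit (S : PosSystem.{u}) (i : S.Index) : S.obj i →+ S.Limit :=
  letI := Classical.decEq S.Index
  AddCommGroup.DirectLimit.of S.obj S.map i

/-- `H` is (isomorphic to) the direct limit of the system as a partially ordered abelian group: the
positive cone of the limit is the union of the images of the positive cones of the groups of the
system. -/
def HasLimit (S : PosSystem.{u}) (H : Type u) [AddCommGroup H] [PartialOrder H] : Prop :=
  ∃ e : S.Limit ≃+ H,
    ∀ z : S.Limit, 0 ≤ e z ↔ ∃ (i : S.Index) (a : S.obj i), 0 ≤ a ∧ S.toLimit i a = z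

end PosSystem

/-- `H` is a direct limit, over a directed set and with positive group homomorphisms, of simple
dimension groups each with finitely many pure traces. -/
def IsLimitOfSimpleFD (H : Type u) [AddCommGroup H] [PartialOrder H] : Prop :=
  ∃ S : PosSystem.{u}, S.HasLimit H ∧
    ∀ i, IsDimensionGroup (S.obj i) ∧ IsSimple (S.obj i) ∧ HasFinitelyManyPureTraces (S.obj i)

/-- `H` is a pro-finite-dimensional dimension group: a dimension group that is a direct limit, over
a directed set and with positive group homomorphisms that respect order units, of approximately
divisible dimension groups with order unit, each with finitely many pure traces. -/
def IsProFD (H : Type u) [AddCommGroup H] [PartialOrder H] : Prop :=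
  IsDimensionGroup H ∧
    ∃ (S : PosSystem.{u}) (v : ∀ i, S.obj i), S.HasLimit H ∧
      (∀ i, IsDimensionGroup (S.obj i) ∧ IsApproximatelyDivisible (S.obj i) ∧
        IsOrderUnit (v i) ∧ (pureTraces (v i)).Finite) ∧
      ∀ i j (h : i ≤ j), IsOrderUnit (S.map i j h (v i))

end OrderedGroup

/-! The argument is the Effros–Handelman–Shen theorem with the strict order put on the building
blocks. Unperforation excludes torsion, so a `p`-divisible dimension group `G` is uniquely
`p`-divisible, and finitely many elements of `G` define a homomorphism `ℤ[1/p]ⁿ → G`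
(`StrictPow.eval`).

Fix an order unit `v`. A `Cell v` is a positive map `ℤⁿ → G` with a chosen strictly positive
preimage of `v`; morphisms are natural-number matrices compatible with the maps and the preimages.
Shen's lemma (`exists_refinement_annihilates`) kills relations by passing to refinements, which
makes cells a filtered category (`Cell.isFiltered`) and the limit of the groups `ℤ[1/p]ⁿ` equal to
`G` as a group (`cellLift_bijective`).

A morphism matrix carries one strictly positive vector to another, so it has no zero row and stays
positive for the strict orders. In the limit the strictly positive vectors give exactly the order
units of `G`: if `v ≤ N • x`, then at a late stage `N` times a lift of `x` dominates the preimage of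
`v` in every coordinate (`exists_eval_eq_of_isOrderUnit`). Hence the limit is the simplification
(`hasLimit_cellSystem`).

Density of `ℤ[1/p]` in `ℝ` makes the strictly ordered blocks simple, approximately divisible
dimension groups; their pure traces are among the finitely many normalized coordinates. The
preimages of `v` are order units respected by the maps, and a simple group is its own
simplification, which settles the simple case. -/

namespace OrderedGroup

open CategoryTheory

/-! ### Refinements of positive families and Shen's lemma. -/

section Riesz

variable {G : Type*} [AddCommGroup G] [PartialOrder G]

/-- A refinement of a finite family `g` of positive elements: a finite family `h` of positive
elements with `g i = ∑ j, M j i • h j` for a matrix `M` of natural numbers. -/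
structure IsRefinement {ι κ : Type*} [Fintype κ] (g : ι → G) (h : κ → G) (M : Matrix κ ι ℕ) :
    Prop where
  nonneg : ∀ j, 0 ≤ h j
  eq_sum : ∀ i, g i = ∑ j, M j i • h j

/-- The matrix `M` annihilates the integer vector `x`. -/
def Annihilates {ι κ : Type*} [Fintype ι] (M : Matrix κ ι ℕ) (x : ι → ℤ) : Prop :=
  ∀ j, ∑ i, (M j i : ℤ) * x i = 0

theorem IsRefinement.refl {ι : Type*} [Fintype ι] [DecidableEq ι] {g : ι → G} (hg : ∀ i, 0 ≤ g i) :
    IsRefinement g g (1 : Matrix ι ι ℕ) :=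
  ⟨hg, fun i => by simp [Matrix.one_apply, ite_smul]⟩

theorem IsRefinement.trans {ι κ l : Type*} [Fintype κ] [Fintype l] {g : ι → G}
    {h : κ → G} {k : l → G} {M : Matrix κ ι ℕ} {N : Matrix l κ ℕ} (hM : IsRefinement g h M)
    (hN : IsRefinement h k N) : IsRefinement g k (N * M) := by
  refine ⟨hN.nonneg, fun i => ?_⟩
  simp_rw [hM.eq_sum i, hN.eq_sum, Matrix.mul_apply, Finset.sum_smul, Finset.smul_sum, smul_smul]
  rw [Finset.sum_comm]
  simp_rw [mul_comm]

/-- A refinement transports integer combinations. -/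
theorem IsRefinement.sum_zsmul {ι κ : Type*} [Fintype ι] [Fintype κ] {g : ι → G}
    {h : κ → G} {M : Matrix κ ι ℕ} (hM : IsRefinement g h M) (x : ι → ℤ) :
    ∑ j, (∑ i, (M j i : ℤ) * x i) • h j = ∑ i, x i • g i := by
  simp_rw [hM.eq_sum, Finset.sum_smul, Finset.smul_sum]
  rw [Finset.sum_comm]
  refine Finset.sum_congr rfl fun i _ => Finset.sum_congr rfl fun j _ => ?_
  rw [mul_comm, mul_smul, natCast_zsmul]

theorem sum_mul_mul {ι κ l : Type*} [Fintype ι] [Fintype κ]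
    (M : Matrix κ ι ℕ) (N : Matrix l κ ℕ) (x : ι → ℤ) (j : l) :
    ∑ i, ((N * M) j i : ℤ) * x i = ∑ k, (N j k : ℤ) * ∑ i, (M k i : ℤ) * x i := by
  simp_rw [Matrix.mul_apply, Nat.cast_sum, Nat.cast_mul, Finset.sum_mul, Finset.mul_sum]
  rw [Finset.sum_comm]
  simp_rw [mul_assoc]

theorem Annihilates.mul {ι κ l : Type*} [Fintype ι] [Fintype κ]
    {M : Matrix κ ι ℕ} {x : ι → ℤ} (h : Annihilates M x) (N : Matrix l κ ℕ) :
    Annihilates (N * M) x := fun j => by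
  rw [sum_mul_mul]
  exact Finset.sum_eq_zero fun k _ => by rw [h k, mul_zero]

theorem Annihilates.of_mul {ι κ l : Type*} [Fintype ι] [Fintype κ]
    {M : Matrix κ ι ℕ} {N : Matrix l κ ℕ} {x : ι → ℤ}
    (h : Annihilates N (fun k => ∑ i, (M k i : ℤ) * x i)) : Annihilates (N * M) x := fun j => by
  rw [sum_mul_mul]
  exact h j

theorem Annihilates.neg {ι κ : Type*} [Fintype ι] {M : Matrix κ ι ℕ} {x : ι → ℤ}
    (h : Annihilates M (-x)) : Annihilates M x := fun j => by
  simpa using h j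

variable [IsOrderedAddMonoid G]

/-- Riesz decomposition, by peeling off one summand at a time: the part `d` taken from `b i`
interpolates between `0`, `a - ∑ b j` below and `a`, `b i` above, so that the remainder `a - d` is
again bounded by the other summands. -/
theorem HasRieszInterpolation.exists_sum_eq (hG : HasRieszInterpolation G) {ι : Type*}
    (s : Finset ι) (b : ι → G) (hb : ∀ i, 0 ≤ b i) (a : G) (ha : 0 ≤ a) (hab : a ≤ ∑ i ∈ s, b i) :
    ∃ f : ι → G, (∀ i, 0 ≤ f i ∧ f i ≤ b i) ∧ (∀ i ∉ s, f i = 0) ∧ ∑ i ∈ s, f i = a := by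
  classical
  induction s using Finset.induction_on generalizing a with
  | empty =>
    rw [Finset.sum_empty] at hab
    exact ⟨fun _ => 0, fun i => ⟨le_rfl, hb i⟩, fun _ _ => rfl, by simp [le_antisymm hab ha]⟩
  | insert i s hi ih =>
    rw [Finset.sum_insert hi] at hab
    obtain ⟨d, hd₁, hd₂, hd₃, hd₄⟩ := hG 0 (a - ∑ j ∈ s, b j) a (b i) ha (hb i)
      (sub_le_self _ (Finset.sum_nonneg fun j _ => hb j)) (sub_le_iff_le_add.2 hab)
    obtain ⟨f, hf₁, hf₂, hf₃⟩ := ih (a - d) (sub_nonneg.2 hd₃) (sub_le_comm.1 hd₂)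
    refine ⟨fun j => if j = i then d else f j, fun j => ?_, fun j hj => ?_, ?_⟩
    · dsimp only
      split_ifs with h
      · exact h ▸ ⟨hd₁, hd₄⟩
      · exact hf₁ j
    · rw [Finset.mem_insert, not_or] at hj
      simp [hj.1, hf₂ j hj.2]
    · rw [Finset.sum_insert hi, if_pos rfl, Finset.sum_congr rfl (g := f), hf₃, add_sub_cancel]
      intro j hj
      rw [if_neg (ne_of_mem_of_not_mem hj hi)]

/-- The elementary step of the Effros–Handelman–Shen argument: an element `g i₀` whose coefficient
`k` is the largest in a relation is split, so that the coefficient `k` occurs less often. -/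
theorem exists_refinement_card_lt (hG : IsDimensionGroup G) {ι : Type} [Fintype ι] [DecidableEq ι]
    (g : ι → G) (hg : ∀ i, 0 ≤ g i) (x : ι → ℤ) (hx : ∑ i, x i • g i = 0) (k : ℕ)
    (hk : ∀ i, |x i| ≤ k + 1) (i₀ : ι) (hi₀ : x i₀ = k + 1) :
    ∃ (h : ι ⊕ ι → G) (M : Matrix (ι ⊕ ι) ι ℕ), IsRefinement g h M ∧
      (∀ j, |∑ i, (M j i : ℤ) * x i| ≤ k + 1) ∧
      (Finset.univ.filter fun j => |∑ i, (M j i : ℤ) * x i| = k + 1).card <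
        (Finset.univ.filter fun i => |x i| = k + 1).card := by
  let s : Finset ι := Finset.univ.filter fun i => x i < 0
  have hi₀s : i₀ ∉ s := by simp [s]; omega
  -- The relation gives `(k + 1) g i₀ ≤ ∑ (-x i) g i ≤ (k + 1) ∑ g i`, both sums over `s`;
  -- unperforation cancels `k + 1`.
  have hle : g i₀ ≤ ∑ i ∈ s, g i := by
    refine sub_nonneg.1 (hG.unperforated (k + 1) _ k.succ_pos ?_)
    have h₁ : ∑ i ∈ s, x i • g i + ∑ i ∈ sᶜ, x i • g i = 0 := by
      rw [Finset.sum_add_sum_compl, hx]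
    have h₂ : x i₀ • g i₀ ≤ ∑ i ∈ sᶜ, x i • g i :=
      Finset.single_le_sum (f := fun i => x i • g i) (fun i hi => zsmul_nonneg (hg i) (by
        simpa [s] using hi)) (by simpa using hi₀s)
    have h₃ : 0 ≤ ∑ i ∈ s, ((k + 1 : ℤ) + x i) • g i :=
      Finset.sum_nonneg fun i _ => zsmul_nonneg (hg i) (by have := neg_le_of_abs_le (hk i); omega)
    simp_rw [add_smul _ (x _), Finset.sum_add_distrib, ← Finset.smul_sum] at h₃
    rw [hi₀] at h₂
    rw [smul_sub, sub_nonneg, ← natCast_zsmul, ← natCast_zsmul]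
    push_cast
    rw [eq_neg_of_add_eq_zero_left h₁, ← sub_eq_add_neg, sub_nonneg] at h₃
    exact h₂.trans h₃
  obtain ⟨f, hf₁, hf₂, hf₃⟩ := hG.interpolation.exists_sum_eq s g hg (g i₀) (hg i₀) hle
  -- The new generators are `g j - f j` and the pieces `f j` of `g i₀`. For `j ∈ s` the piece `f j`
  -- lies in both `g i₀` and `g j`, so its coefficient is `k + 1 + x j`, which lies in `[0, k]`; `g
  -- j - f j` keeps `x j`. The row of `inl i₀` is zero, which removes one coefficient of size `k +
  -- 1`.
  let M : Matrix (ι ⊕ ι) ι ℕ := fun j i => Sum.elim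
    (fun j => if i = j ∧ j ≠ i₀ then 1 else 0)
    (fun j => if (i = i₀ ∨ i = j) ∧ j ∈ s then 1 else 0) j
  have hinl : ∀ j, ∑ i, (M (.inl j) i : ℤ) * x i = if j = i₀ then 0 else x j := by
    intro j
    by_cases h : j = i₀ <;> simp [M, h]
  have hinr : ∀ j, ∑ i, (M (.inr j) i : ℤ) * x i = if j ∈ s then k + 1 + x j else 0 := by
    intro j
    by_cases h : j ∈ s
    · have hj : i₀ ≠ j := fun h' => hi₀s (h' ▸ h)
      have : ∀ i, (M (.inr j) i : ℤ) * x i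
          = (if i = i₀ then x i else 0) + if i = j then x i else 0 := by
        intro i
        by_cases h₁ : i = i₀
        · have : i ≠ j := fun h' => hj (h₁ ▸ h')
          simp [M, h, h₁, hj]
        · simp [M, h, h₁]
      simp [this, Finset.sum_add_distrib, h, hi₀]
    · simp [M, h]
  have hlt : ∀ j ∈ s, |(k : ℤ) + 1 + x j| < k + 1 := by
    intro j hj
    have h₁ : x j < 0 := by simpa [s] using hj
    have h₂ := neg_le_of_abs_le (hk j)
    rw [abs_of_nonneg (by omega)]
    omega
  refine ⟨Sum.elim (fun i => g i - f i) f, M, ⟨?_, ?_⟩, ?_, ?_⟩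
  · rintro (j | j)
    · exact sub_nonneg.2 (hf₁ j).2
    · exact (hf₁ j).1
  · intro i
    rw [Fintype.sum_sum_type]
    by_cases h : i = i₀
    · subst h
      simp only [M, Sum.elim_inl, Sum.elim_inr]
      rw [Finset.sum_eq_zero, zero_add]
      · simp only [true_or, true_and, ite_smul, one_smul, zero_smul]
        rw [← Finset.sum_filter, Finset.filter_mem_eq_inter, Finset.univ_inter, hf₃]
      · rintro j -
        by_cases h : i = j <;> simp [h]
    · rw [Finset.sum_eq_single i, Finset.sum_eq_single i]
      · by_cases hi : i ∈ s
        · simp [M, h, hi]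
        · simp [M, h, hi, hf₂ i hi]
      · rintro j - hj
        simp [M, h, hj.symm]
      · simp
      · rintro j - hj
        simp [M, hj.symm]
      · simp
  · rintro (j | j)
    · rw [hinl]
      split_ifs
      · simp; omega
      · exact hk j
    · rw [hinr]
      split_ifs with h
      · exact (hlt j h).le
      · simp; omega
  · have hsub : (Finset.univ.filter fun j => |∑ i, (M j i : ℤ) * x i| = k + 1) ⊆
        ((Finset.univ.filter fun i => |x i| = k + 1).erase i₀).map .inl := by
      rintro (j | j) hj
      · rw [Finset.mem_filter, hinl] at hj
        split_ifs at hj with h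
        · simp at hj; omega
        · simpa [h] using hj
      · rw [Finset.mem_filter, hinr] at hj
        split_ifs at hj with h
        · exact absurd hj.2 (hlt j h).ne
        · simp at hj; omega
    refine (Finset.card_le_card hsub).trans_lt ?_
    rw [Finset.card_map]
    exact Finset.card_erase_lt_of_mem (Finset.mem_filter.2
      ⟨Finset.mem_univ _, by rw [hi₀, abs_of_nonneg (by omega)]⟩)

/-- **Shen's lemma**: a relation among finitely many positive elements of a dimension group becomes
trivial in some refinement. -/
theorem exists_refinement_annihilates (hG : IsDimensionGroup G) {ι : Type} [Fintype ι]
    (g : ι → G) (hg : ∀ i, 0 ≤ g i) (x : ι → ℤ) (hx : ∑ i, x i • g i = 0) :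
    ∃ (κ : Type) (_ : Fintype κ) (h : κ → G) (M : Matrix κ ι ℕ),
      IsRefinement g h M ∧ Annihilates M x := by
  classical
  obtain ⟨k, hk⟩ : ∃ k : ℕ, ∀ i, |x i| ≤ k :=
    ⟨∑ i, (x i).natAbs, fun i => by
      rw [Int.abs_eq_natAbs, Int.ofNat_le]
      exact Finset.single_le_sum (f := fun i => (x i).natAbs) (by simp) (Finset.mem_univ i)⟩
  induction k generalizing ι with
  | zero =>
    refine ⟨ι, inferInstance, g, 1, .refl hg, fun j => Finset.sum_eq_zero fun i _ => ?_⟩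
    have hi : x i = 0 := abs_nonpos_iff.1 (by exact_mod_cast hk i)
    rw [hi, mul_zero]
  | succ k ih =>
    push_cast at hk
    -- Inner induction on how many coefficients attain the bound; when none does, the outer
    -- induction on the bound applies.
    induction hN : (Finset.univ.filter fun i => |x i| = k + 1).card using Nat.strong_induction_on
      generalizing ι with
    | _ N ihN =>
      subst hN
      by_cases hne : ∃ i, |x i| = k + 1
      · obtain ⟨i, hi⟩ := hne
        wlog hi' : x i = k + 1 generalizing x
        · obtain ⟨κ, _, h, M, h₁, h₂⟩ := this (-x) (by simpa using hx) (by simpa using hk)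
            (by simpa using ihN) (by simpa using hi) (by
              rcases abs_eq (a := x i) (b := k + 1) (by omega) |>.1 hi with h | h
              · exact absurd h hi'
              · simp [h])
          exact ⟨κ, _, h, M, h₁, h₂.neg⟩
        obtain ⟨h, M, h₁, h₂, h₃⟩ := exists_refinement_card_lt hG g hg x hx k hk i hi'
        obtain ⟨κ, _, h', N, h₄, h₅⟩ := ihN _ h₃ h h₁.nonneg _ ((h₁.sum_zsmul x).trans hx) h₂ rfl
        exact ⟨κ, _, h', N * M, h₁.trans h₄, h₅.of_mul⟩
      · refine ih g hg x hx fun i => ?_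
        have h₁ := hk i
        have h₂ : |x i| ≠ k + 1 := fun h => hne ⟨i, h⟩
        omega

/-- Relations are killed one after another: each is pushed forward to the current refinement, and
those already killed stay killed under further refinement. -/
theorem exists_refinement_annihilates_list (hG : IsDimensionGroup G) {ι : Type} [Fintype ι]
    (g : ι → G) (hg : ∀ i, 0 ≤ g i) (X : List (ι → ℤ)) (hX : ∀ x ∈ X, ∑ i, x i • g i = 0) :
    ∃ (κ : Type) (_ : Fintype κ) (h : κ → G) (M : Matrix κ ι ℕ),
      IsRefinement g h M ∧ ∀ x ∈ X, Annihilates M x := by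
  classical
  induction X with
  | nil => exact ⟨ι, inferInstance, g, 1, .refl hg, by simp⟩
  | cons x X ih =>
    obtain ⟨κ, _, h, M, h₁, h₂⟩ := ih fun y hy => hX y (List.mem_cons_of_mem _ hy)
    obtain ⟨l, _, h', N, h₃, h₄⟩ := exists_refinement_annihilates hG h h₁.nonneg
      (fun j => ∑ i, (M j i : ℤ) * x i) ((h₁.sum_zsmul x).trans (hX x List.mem_cons_self))
    refine ⟨l, _, h', N * M, h₁.trans h₃, fun y hy => ?_⟩
    rcases List.mem_cons.1 hy with rfl | hy
    · exact h₄.of_mul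
    · exact (h₂ y hy).mul N

end Riesz

/-! ### The group `ℤ[1/p]ⁿ` with the strict order, and its traces. -/

section StrictPow

/-- The additive group `ℤ[1/p]`, as a subgroup of `ℚ`. -/
def invPow (p : ℕ) : AddSubgroup ℚ where
  carrier := {q | ∃ (k : ℕ) (m : ℤ), (p : ℚ) ^ k * q = m}
  zero_mem' := ⟨0, 0, by simp⟩
  add_mem' := by
    rintro a b ⟨k, m, h⟩ ⟨l, m', h'⟩
    refine ⟨k + l, p ^ l * m + p ^ k * m', ?_⟩
    push_cast
    rw [← h, ← h']
    ring
  neg_mem' := by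
    rintro a ⟨k, m, h⟩
    exact ⟨k, -m, by push_cast; rw [← h]; ring⟩

theorem intCast_mem_invPow (p : ℕ) (m : ℤ) : (m : ℚ) ∈ invPow p := ⟨0, m, by simp⟩

theorem exists_mem_invPow_between {p : ℕ} (hp : 1 < p) {a b : ℝ} (hab : a < b) :
    ∃ q ∈ invPow p, a < q ∧ (q : ℝ) < b := by
  have hp₀ : (1 : ℝ) < p := by exact_mod_cast hp
  obtain ⟨k, hk⟩ := pow_unbounded_of_one_lt (1 / (b - a)) hp₀
  have hpk : (0 : ℝ) < (p : ℝ) ^ k := by positivity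
  rw [div_lt_iff₀ (sub_pos.2 hab)] at hk
  -- Since `p ^ k * (b - a) > 1`, the first integer beyond `p ^ k * a` is still below `p ^ k * b`.
  refine ⟨((⌊(p : ℝ) ^ k * a⌋ + 1 : ℤ) : ℚ) / (p : ℚ) ^ k, ⟨k, _, mul_div_cancel₀ _ ?_⟩, ?_, ?_⟩
  · have : p ≠ 0 := by omega
    positivity
  · push_cast
    rw [lt_div_iff₀ hpk, mul_comm]
    exact Int.lt_floor_add_one _
  · push_cast
    rw [div_lt_iff₀ hpk]
    linarith [Int.floor_le ((p : ℝ) ^ k * a)]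

/-- The group `ℤ[1/p]ⁿ`, which will be given the strict order. -/
def StrictPow (p n : ℕ) : Type u :=
  ULift.{u} (AddSubgroup.pi Set.univ fun _ : Fin n => invPow p)

namespace StrictPow

variable {p n : ℕ}

instance : AddCommGroup (StrictPow.{u} p n) :=
  inferInstanceAs (AddCommGroup (ULift.{u} (AddSubgroup.pi Set.univ fun _ : Fin n => invPow p)))

/-- The `i`-th coordinate. -/
def coord (i : Fin n) : StrictPow.{u} p n →+ ℚ where
  toFun x := x.down.1 i
  map_zero' := rfl
  map_add' _ _ := rfl

/-- The element with given coordinates. -/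
def mk (x : Fin n → ℚ) (hx : ∀ i, x i ∈ invPow p) : StrictPow.{u} p n :=
  ⟨⟨x, fun i _ => hx i⟩⟩

@[simp]
theorem coord_mk (x : Fin n → ℚ) (hx : ∀ i, x i ∈ invPow p) (i : Fin n) :
    coord i (mk.{u} x hx) = x i := rfl

theorem coord_mem (x : StrictPow.{u} p n) (i : Fin n) : coord i x ∈ invPow p :=
  x.down.2 i trivial

@[ext]
theorem ext {x y : StrictPow.{u} p n} (h : ∀ i, coord i x = coord i y) : x = y :=
  ULift.down_injective (Subtype.ext (funext h))

/-- The element with given integer coordinates. -/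
def ofInt (z : Fin n → ℤ) : StrictPow.{u} p n := mk (fun i => z i) fun _ => intCast_mem_invPow p _

@[simp]
theorem coord_ofInt (z : Fin n → ℤ) (i : Fin n) : coord i (ofInt.{u} (p := p) z) = z i := rfl

/-- A common denominator for the coordinates. -/
theorem exists_pow_nsmul_eq (x : StrictPow.{u} p n) :
    ∃ (k : ℕ) (z : Fin n → ℤ), p ^ k • x = ofInt z := by
  choose k z hz using coord_mem x
  refine ⟨∑ i, k i, fun i => (p : ℤ) ^ (∑ j ∈ Finset.univ.erase i, k j) * z i, ?_⟩
  ext i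
  rw [map_nsmul, coord_ofInt, nsmul_eq_mul]
  push_cast
  rw [← hz i, ← mul_assoc, ← pow_add, Finset.sum_erase_add _ _ (Finset.mem_univ i)]

/-- The strict order: `x ≤ y` if `x = y` or every coordinate of `x` is smaller than that of `y`. -/
instance : PartialOrder (StrictPow.{u} p n) where
  le x y := x = y ∨ ∀ i, coord i x < coord i y
  le_refl x := Or.inl rfl
  le_trans x y z := by
    rintro (rfl | h) (rfl | h')
    · exact Or.inl rfl
    · exact Or.inr h'
    · exact Or.inr h
    · exact Or.inr fun i => (h i).trans (h' i)
  le_antisymm x y := by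
    rintro (rfl | h) (h' | h')
    · rfl
    · rfl
    · exact h'.symm
    · ext i
      exact absurd (h i) (h' i).asymm

theorem le_iff {x y : StrictPow.{u} p n} : x ≤ y ↔ x = y ∨ ∀ i, coord i x < coord i y := Iff.rfl

theorem nonneg_iff {x : StrictPow.{u} p n} : 0 ≤ x ↔ x = 0 ∨ ∀ i, 0 < coord i x := by
  rw [le_iff, eq_comm]
  simp only [map_zero]

instance : IsOrderedAddMonoid (StrictPow.{u} p n) where
  add_le_add_left x y hxy z := by
    rcases hxy with rfl | h
    · exact le_rfl
    · exact Or.inr fun i => by simpa using h i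

theorem coord_nonneg {x : StrictPow.{u} p n} (hx : 0 ≤ x) (i : Fin n) : 0 ≤ coord i x := by
  rcases nonneg_iff.1 hx with rfl | h
  · simp
  · exact (h i).le

theorem isOrderUnit_of_coord_pos {v : StrictPow.{u} p n} (hv : ∀ i, 0 < coord i v) :
    IsOrderUnit v := by
  refine ⟨nonneg_iff.2 (Or.inr hv), fun x => ?_⟩
  choose N hN using fun i => exists_nat_gt (coord i x / coord i v)
  refine ⟨∑ i, N i, Or.inr fun i => ?_⟩
  rw [map_nsmul, nsmul_eq_mul, ← div_lt_iff₀ (hv i)]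
  refine (hN i).trans_le ?_
  exact_mod_cast Finset.single_le_sum (f := N) (by simp) (Finset.mem_univ i)

theorem coord_pos_of_isOrderUnit {v : StrictPow.{u} p n} (hv : IsOrderUnit v) (i : Fin n) :
    0 < coord i v := by
  rcases nonneg_iff.1 hv.1 with rfl | h
  · obtain ⟨N, hN⟩ := hv.2 (ofInt 1)
    rw [smul_zero] at hN
    rcases hN with h | h
    · simpa using congrArg (coord i) h
    · have := h i
      norm_num at this
  · exact h i

theorem isOrderUnit_iff {v : StrictPow.{u} p n} : IsOrderUnit v ↔ ∀ i, 0 < coord i v :=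
  ⟨fun hv i => coord_pos_of_isOrderUnit hv i, isOrderUnit_of_coord_pos⟩

theorem exists_isOrderUnit : ∃ v : StrictPow.{u} p n, IsOrderUnit v :=
  ⟨ofInt 1, isOrderUnit_iff.2 fun i => by simp⟩

/-- For interpolation, an equality among the four inequalities supplies the interpolant itself. If
all are strict, density of `ℤ[1/p]` supplies it coordinate by coordinate. -/
theorem isDimensionGroup (hp : 1 < p) : IsDimensionGroup (StrictPow.{u} p n) where
  directed := ⟨fun x y => by
    choose a ha using fun i => exists_nat_gt (max (coord i x) (coord i y))
    exact ⟨ofInt fun i => a i,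
      Or.inr fun i => by simpa using (le_max_left _ _).trans_lt (ha i),
      Or.inr fun i => by simpa using (le_max_right _ _).trans_lt (ha i)⟩⟩
  unperforated := fun k x hk hx => by
    have hk' : (0 : ℚ) < k := by exact_mod_cast hk
    rcases nonneg_iff.1 hx with h | h
    · refine le_of_eq (ext fun i => ?_)
      have := congrArg (coord i) h
      rw [map_nsmul, map_zero, nsmul_eq_mul] at this
      rw [map_zero, (mul_eq_zero.1 this).resolve_left hk'.ne']
    · refine nonneg_iff.2 (Or.inr fun i => ?_)
      have := h i
      rw [map_nsmul, nsmul_eq_mul] at this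
      exact pos_of_mul_pos_right this hk'.le
  interpolation := by
    rintro a₁ a₂ b₁ b₂ (rfl | h₁₁) h₁₂ h₂₁ h₂₂
    · exact ⟨a₁, le_rfl, h₂₁, le_rfl, h₁₂⟩
    rcases h₁₂ with rfl | h₁₂
    · exact ⟨a₁, le_rfl, h₂₂, Or.inr h₁₁, le_rfl⟩
    rcases h₂₁ with rfl | h₂₁
    · exact ⟨a₂, Or.inr h₁₁, le_rfl, le_rfl, h₂₂⟩
    rcases h₂₂ with rfl | h₂₂
    · exact ⟨a₂, Or.inr h₁₂, le_rfl, Or.inr h₂₁, le_rfl⟩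
    have h : ∀ i, ((max (coord i a₁) (coord i a₂) : ℚ) : ℝ) <
        ((min (coord i b₁) (coord i b₂) : ℚ) : ℝ) := fun i => by
      rw [Rat.cast_lt, max_lt_iff, lt_min_iff, lt_min_iff]
      exact ⟨⟨h₁₁ i, h₁₂ i⟩, h₂₁ i, h₂₂ i⟩
    choose q hq hlt hgt using fun i => exists_mem_invPow_between hp (h i)
    simp only [Rat.cast_lt, max_lt_iff, lt_min_iff] at hlt hgt
    exact ⟨mk q hq, Or.inr fun i => (hlt i).1, Or.inr fun i => (hlt i).2,
      Or.inr fun i => (hgt i).1, Or.inr fun i => (hgt i).2⟩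

/-- Directedness puts a strictly positive element into any nonzero ideal. Such an element is an
order unit, and convexity does the rest. -/
theorem isSimple : IsSimple (StrictPow.{u} p n) := by
  rintro H ⟨hconv, hdir⟩
  refine or_iff_not_imp_left.2 fun hH => ?_
  obtain ⟨x, hx, hx₀⟩ := H.bot_or_exists_ne_zero.resolve_left hH
  obtain ⟨v, hvH, hv⟩ : ∃ v ∈ H, ∀ i, 0 < coord i v := by
    obtain ⟨y, hy, h₀, h₁⟩ := hdir 0 H.zero_mem x hx
    rcases nonneg_iff.1 h₀ with rfl | h
    · refine ⟨-x, H.neg_mem hx, fun i => ?_⟩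
      simpa using (h₁.resolve_left hx₀) i
    · exact ⟨y, hy, h⟩
  have hv' := isOrderUnit_of_coord_pos hv
  refine (AddSubgroup.eq_top_iff' H).2 fun y => ?_
  obtain ⟨k, hk⟩ := hv'.2 y
  obtain ⟨l, hl⟩ := hv'.2 (-y)
  exact hconv.out (H.neg_mem (H.nsmul_mem hvH l)) (H.nsmul_mem hvH k) ⟨neg_le.1 hl, hk⟩

/-- A trace of `ℤ[1/p]ⁿ` is a nonnegative combination of the coordinates. -/
theorem exists_trace_eq_sum (hp : p ≠ 0) {v : StrictPow.{u} p n} {τ : StrictPow.{u} p n →+ ℝ}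
    (hτ : τ ∈ traceSpace v) :
    ∃ t : Fin n → ℝ, (∀ i, 0 ≤ t i) ∧ ∀ x, τ x = ∑ i, t i * (coord i x : ℝ) := by
  refine ⟨fun i => τ (ofInt (Pi.single i 1)), fun i => ?_, fun x => ?_⟩
  -- A unit vector need not be positive for the strict order, but `N • eᵢ + 1` is, for every `N`; a
  -- negative value at `eᵢ` would make the trace negative there for large `N`.
  · by_contra! h
    obtain ⟨N, hN⟩ := exists_nat_gt (τ (ofInt 1) / -τ (ofInt (Pi.single i 1)))
    rw [div_lt_iff₀ (neg_pos.2 h)] at hN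
    have := hτ.1 (N • ofInt (Pi.single i 1) + ofInt 1) (nonneg_iff.2 (Or.inr fun j => by
      have : (0 : ℤ) ≤ (Pi.single i 1 : Fin n → ℤ) j := by
        rw [Pi.single_apply]
        split_ifs <;> simp
      have : (0 : ℚ) ≤ N * ((Pi.single i 1 : Fin n → ℤ) j : ℤ) := by positivity
      rw [map_add, map_nsmul, nsmul_eq_mul, coord_ofInt, coord_ofInt]
      simp only [Pi.one_apply, Int.cast_one]
      linarith))
    rw [map_add, map_nsmul, nsmul_eq_mul] at this
    linarith
  · obtain ⟨k, z, hz⟩ := exists_pow_nsmul_eq x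
    have hpk : (p : ℝ) ^ k ≠ 0 := by positivity
    have hsum : ofInt.{u} (p := p) z = ∑ i, z i • ofInt (Pi.single i 1) := by
      ext j
      simp [map_sum, Pi.single_apply, Finset.sum_ite_eq]
    have hc : ∀ i, (p : ℝ) ^ k * (coord i x : ℝ) = z i := fun i => by
      have := congrArg (coord i) hz
      rw [map_nsmul, nsmul_eq_mul, coord_ofInt] at this
      exact_mod_cast this
    have := congrArg τ (hz.trans hsum)
    simp only [map_nsmul, nsmul_eq_mul, map_sum, map_zsmul, zsmul_eq_mul, Nat.cast_pow] at this
    refine mul_left_cancel₀ hpk (this.trans ?_)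
    rw [Finset.mul_sum]
    exact Finset.sum_congr rfl fun i _ => by rw [← hc i]; ring

/-- The `i`-th coordinate, normalized at `v`. -/
noncomputable def normCoord (v : StrictPow.{u} p n) (i : Fin n) : StrictPow.{u} p n →+ ℝ :=
  (AddMonoidHom.mulRight ((coord i v : ℝ)⁻¹)).comp
    ((Rat.castHom ℝ).toAddMonoidHom.comp (coord i))

theorem normCoord_apply (v : StrictPow.{u} p n) (i : Fin n) (x : StrictPow.{u} p n) :
    normCoord v i x = (coord i x : ℝ) * (coord i v : ℝ)⁻¹ := rfl

/-- A trace is a convex combination of normalized coordinates with weights `t i * coord i v`.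
Splitting off one coordinate of nonzero weight `r` leaves nothing if `r = 1`; otherwise the rescaled
rest `σ` is a trace and extremality applies. -/
theorem exists_eq_normCoord (hp : p ≠ 0) {v : StrictPow.{u} p n} (hv : IsOrderUnit v)
    {τ : StrictPow.{u} p n →+ ℝ} (hτ : τ ∈ pureTraces v) : ∃ i, τ = normCoord v i := by
  obtain ⟨hτv, hext⟩ := mem_extremePoints.1 hτ
  obtain ⟨t, ht, hsum⟩ := exists_trace_eq_sum hp hτv
  have hv' : ∀ i, (0 : ℝ) < coord i v := fun i => by exact_mod_cast isOrderUnit_iff.1 hv i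
  have h1 : ∑ i, t i * (coord i v : ℝ) = 1 := by rw [← hsum, hτv.2]
  obtain ⟨i, -, hi⟩ : ∃ i ∈ Finset.univ, t i * (coord i v : ℝ) ≠ 0 :=
    Finset.exists_ne_zero_of_sum_ne_zero (by rw [h1]; exact one_ne_zero)
  refine ⟨i, ?_⟩
  set r := t i * (coord i v : ℝ) with hr
  have hr₀ : 0 < r := lt_of_le_of_ne (mul_nonneg (ht i) (hv' i).le) hi.symm
  have hsplit : ∀ x, τ x = r * normCoord v i x +
      ∑ j ∈ Finset.univ.erase i, t j * (coord j x : ℝ) := fun x => by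
    rw [hsum, ← Finset.add_sum_erase _ _ (Finset.mem_univ i), normCoord_apply, hr]
    have := (hv' i).ne'
    field_simp
  have hnorm : normCoord v i ∈ traceSpace v := by
    refine ⟨fun x hx => ?_, ?_⟩
    · rw [normCoord_apply]
      exact mul_nonneg (by exact_mod_cast coord_nonneg hx i) (inv_nonneg.2 (hv' i).le)
    · rw [normCoord_apply, mul_inv_cancel₀ (hv' i).ne']
  have hrest : ∑ j ∈ Finset.univ.erase i, t j * (coord j v : ℝ) = 1 - r := by
    have := hsplit v
    rw [hτv.2, hnorm.2] at this
    linarith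
  have hrest₀ : ∀ j ∈ Finset.univ.erase i, 0 ≤ t j * (coord j v : ℝ) :=
    fun j _ => mul_nonneg (ht j) (hv' j).le
  rcases (sub_nonneg.1 (hrest ▸ Finset.sum_nonneg hrest₀)).eq_or_lt with hr₁ | hr₁
  · rw [hr₁, sub_self, Finset.sum_eq_zero_iff_of_nonneg hrest₀] at hrest
    ext x
    rw [hsplit, hr₁, one_mul, add_eq_left]
    refine Finset.sum_eq_zero fun j hj => ?_
    rw [(mul_eq_zero.1 (hrest j hj)).resolve_right (hv' j).ne', zero_mul]
  · have hr₂ : 0 < 1 - r := sub_pos.2 hr₁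
    let σ : StrictPow.{u} p n →+ ℝ := (1 - r)⁻¹ • (τ - r • normCoord v i)
    have hσ : ∀ x, σ x = (1 - r)⁻¹ * ∑ j ∈ Finset.univ.erase i, t j * (coord j x : ℝ) := by
      intro x
      change (1 - r)⁻¹ * (τ x - r * normCoord v i x) = _
      rw [hsplit, add_sub_cancel_left]
    have hσv : σ ∈ traceSpace v := by
      refine ⟨fun x hx => ?_, ?_⟩
      · rw [hσ]
        exact mul_nonneg (inv_nonneg.2 hr₂.le) (Finset.sum_nonneg fun j _ =>
          mul_nonneg (ht j) (by exact_mod_cast coord_nonneg hx j))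
      · rw [hσ, hrest, inv_mul_cancel₀ hr₂.ne']
    refine (hext _ hnorm σ hσv ⟨r, 1 - r, hr₀, hr₂, by ring, ?_⟩).1.symm
    rw [smul_inv_smul₀ hr₂.ne', add_sub_cancel]

theorem finite_pureTraces (hp : p ≠ 0) {v : StrictPow.{u} p n} (hv : IsOrderUnit v) :
    (pureTraces v).Finite :=
  (Set.finite_range (normCoord v)).subset fun _ hτ =>
    (exists_eq_normCoord hp hv hτ).imp fun _ h => h.symm

theorem hasFinitelyManyPureTraces (hp : p ≠ 0) :
    HasFinitelyManyPureTraces (StrictPow.{u} p n) :=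
  ⟨exists_isOrderUnit, fun _ hv => finite_pureTraces hp hv⟩

theorem isApproximatelyDivisible (hp : 1 < p) : IsApproximatelyDivisible (StrictPow.{u} p n) := by
  refine ⟨exists_isOrderUnit, fun v hv τ hτ => ?_⟩
  obtain ⟨i, rfl⟩ := exists_eq_normCoord (by omega) hv hτ
  have hvi : (0 : ℝ) < coord i v := by exact_mod_cast isOrderUnit_iff.1 hv i
  refine dense_of_exists_between fun a b hab => ?_
  obtain ⟨q, hq, h₁, h₂⟩ := exists_mem_invPow_between hp (mul_lt_mul_of_pos_right hab hvi)
  refine ⟨_, ⟨mk (fun _ => q) fun _ => hq, rfl⟩, ?_⟩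
  rw [normCoord_apply, coord_mk, ← div_eq_mul_inv]
  exact ⟨(lt_div_iff₀ hvi).2 h₁, (div_lt_iff₀ hvi).2 h₂⟩

end StrictPow

end StrictPow

/-! ### Matrices acting on `ℤ[1/p]ⁿ`, and evaluation in a uniquely `p`-divisible group. -/

namespace StrictPow

variable {p n m l : ℕ}

/-- The action of a matrix of natural numbers. -/
def act (M : Matrix (Fin m) (Fin n) ℕ) : StrictPow.{u} p n →+ StrictPow.{u} p m where
  toFun x := mk (fun j => ∑ i, (M j i : ℚ) * coord i x) fun j => AddSubgroup.sum_mem _ fun i _ => by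
    rw [← nsmul_eq_mul]
    exact AddSubgroup.nsmul_mem _ (coord_mem x i) _
  map_zero' := by ext; simp
  map_add' x y := by ext; simp [mul_add, Finset.sum_add_distrib]

@[simp]
theorem coord_act (M : Matrix (Fin m) (Fin n) ℕ) (x : StrictPow.{u} p n) (j : Fin m) :
    coord j (act M x) = ∑ i, (M j i : ℚ) * coord i x := rfl

theorem act_one (x : StrictPow.{u} p n) : act 1 x = x := by
  ext j
  simp [Matrix.one_apply]

theorem act_mul (N : Matrix (Fin l) (Fin m) ℕ) (M : Matrix (Fin m) (Fin n) ℕ)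
    (x : StrictPow.{u} p n) : act (N * M) x = act N (act M x) := by
  ext j
  simp only [coord_act, Matrix.mul_apply, Nat.cast_sum, Nat.cast_mul, Finset.sum_mul,
    Finset.mul_sum]
  rw [Finset.sum_comm]
  simp_rw [mul_assoc]

theorem act_ofInt (M : Matrix (Fin m) (Fin n) ℕ) (z : Fin n → ℤ) :
    act M (ofInt.{u} (p := p) z) = ofInt fun j => ∑ i, (M j i : ℤ) * z i := by
  ext j
  simp

/-- A matrix without zero rows acts positively for the strict orders. -/
theorem coord_act_pos {M : Matrix (Fin m) (Fin n) ℕ} (hM : ∀ j, ∃ i, M j i ≠ 0)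
    {x : StrictPow.{u} p n} (hx : ∀ i, 0 < coord i x) (j : Fin m) : 0 < coord j (act M x) := by
  obtain ⟨i, hi⟩ := hM j
  rw [coord_act]
  refine Finset.sum_pos' (fun k _ => mul_nonneg (Nat.cast_nonneg _) (hx k).le)
    ⟨i, Finset.mem_univ i, mul_pos ?_ (hx i)⟩
  exact_mod_cast Nat.pos_of_ne_zero hi

theorem coord_act_nonneg (M : Matrix (Fin m) (Fin n) ℕ)
    {x : StrictPow.{u} p n} (hx : ∀ i, 0 ≤ coord i x) (j : Fin m) : 0 ≤ coord j (act M x) :=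
  Finset.sum_nonneg fun i _ => mul_nonneg (Nat.cast_nonneg _) (hx i)

section Eval

variable {G : Type*} [AddCommGroup G]

theorem pow_nsmul_injective (hinj : ∀ x : G, p • x = 0 → x = 0) (k : ℕ) {x y : G}
    (h : p ^ k • x = p ^ k • y) : x = y := by
  rw [← sub_eq_zero, ← nsmul_sub] at h
  refine sub_eq_zero.1 ?_
  induction k with
  | zero => simpa using h
  | succ k ih => exact ih (hinj _ (by rwa [← mul_nsmul', ← pow_succ']))

theorem exists_pow_nsmul_eq_of_div (hdiv : ∀ x : G, ∃ y : G, p • y = x) (k : ℕ) (x : G) :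
    ∃ y, p ^ k • y = x := by
  induction k generalizing x with
  | zero => exact ⟨x, by simp⟩
  | succ k ih =>
    obtain ⟨y, hy⟩ := ih x
    obtain ⟨y', rfl⟩ := hdiv y
    exact ⟨y', by rw [pow_succ, mul_nsmul', hy]⟩

/-- Elements of a uniquely `p`-divisible group define a homomorphism from `ℤ[1/p]ⁿ`. -/
theorem exists_eval (hinj : ∀ x : G, p • x = 0 → x = 0)
    (hdiv : ∀ x : G, ∃ y : G, p • y = x) (g : Fin n → G) :
    ∃ φ : StrictPow.{u} p n →+ G, ∀ z, φ (ofInt z) = ∑ i, z i • g i := by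
  -- Asking for the equation at every denominator `p ^ k` makes the value independent of choices, so
  -- additivity can be checked at a common denominator.
  have key : ∀ x : StrictPow.{u} p n, ∃ y : G, ∀ (k : ℕ) (z : Fin n → ℤ), p ^ k • x = ofInt z →
      p ^ k • y = ∑ i, z i • g i := fun x => by
    obtain ⟨k, z, hz⟩ := exists_pow_nsmul_eq x
    obtain ⟨y, hy⟩ := exists_pow_nsmul_eq_of_div hdiv k (∑ i, z i • g i)
    refine ⟨y, fun l w hw => pow_nsmul_injective hinj k ?_⟩
    have h : ∀ i, (p ^ k : ℕ) * w i = (p ^ l : ℕ) * z i := fun i => by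
      have h : coord i (p ^ k • p ^ l • x) = coord i (p ^ l • p ^ k • x) := by rw [smul_comm]
      rw [hz, hw, map_nsmul, map_nsmul, coord_ofInt, coord_ofInt, nsmul_eq_mul, nsmul_eq_mul] at h
      exact_mod_cast h
    rw [smul_comm, hy, Finset.smul_sum, Finset.smul_sum]
    refine Finset.sum_congr rfl fun i _ => ?_
    rw [← natCast_zsmul, ← natCast_zsmul, smul_smul, smul_smul, h]
  choose φ hφ using key
  refine ⟨⟨⟨φ, ?_⟩, fun x y => ?_⟩, fun z => ?_⟩
  · simpa using hφ 0 0 0 (by ext; simp)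
  · obtain ⟨k, z, hz⟩ := exists_pow_nsmul_eq x
    obtain ⟨l, w, hw⟩ := exists_pow_nsmul_eq y
    refine pow_nsmul_injective hinj (k + l) ?_
    have h₁ : p ^ (k + l) • x = ofInt fun i => (p ^ l : ℕ) * z i := by
      rw [add_comm, pow_add, mul_nsmul', hz]
      ext
      simp
    have h₂ : p ^ (k + l) • y = ofInt fun i => (p ^ k : ℕ) * w i := by
      rw [pow_add, mul_nsmul', hw]
      ext
      simp
    have h₃ : p ^ (k + l) • (x + y) = ofInt fun i => (p ^ l : ℕ) * z i + (p ^ k : ℕ) * w i := by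
      rw [smul_add, h₁, h₂]
      ext
      simp
    dsimp only
    rw [smul_add, hφ _ _ _ h₁, hφ _ _ _ h₂, hφ _ _ _ h₃, ← Finset.sum_add_distrib]
    simp_rw [add_smul]
  · simpa using hφ (ofInt z) 0 z (by simp)

/-- The homomorphism from `ℤ[1/p]ⁿ` given by elements of a uniquely `p`-divisible group. -/
noncomputable def eval (hinj : ∀ x : G, p • x = 0 → x = 0)
    (hdiv : ∀ x : G, ∃ y : G, p • y = x) (g : Fin n → G) : StrictPow.{u} p n →+ G :=
  (exists_eval hinj hdiv g).choose

theorem eval_ofInt (hinj : ∀ x : G, p • x = 0 → x = 0)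
    (hdiv : ∀ x : G, ∃ y : G, p • y = x) (g : Fin n → G) (z : Fin n → ℤ) :
    eval.{u} hinj hdiv g (ofInt z) = ∑ i, z i • g i :=
  (exists_eval hinj hdiv g).choose_spec z

theorem pow_nsmul_eval (hinj : ∀ x : G, p • x = 0 → x = 0)
    (hdiv : ∀ x : G, ∃ y : G, p • y = x) (g : Fin n → G) {x : StrictPow.{u} p n} {k : ℕ}
    {z : Fin n → ℤ} (h : p ^ k • x = ofInt z) :
    p ^ k • eval hinj hdiv g x = ∑ i, z i • g i := by
  rw [← map_nsmul, h, eval_ofInt]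

theorem eval_act [PartialOrder G] (hinj : ∀ x : G, p • x = 0 → x = 0)
    (hdiv : ∀ x : G, ∃ y : G, p • y = x) {g : Fin n → G} {h : Fin m → G}
    {M : Matrix (Fin m) (Fin n) ℕ} (hM : IsRefinement g h M) (x : StrictPow.{u} p n) :
    eval hinj hdiv h (act M x) = eval hinj hdiv g x := by
  obtain ⟨k, z, hz⟩ := exists_pow_nsmul_eq x
  refine pow_nsmul_injective hinj k ?_
  rw [← map_nsmul, ← map_nsmul, hz, act_ofInt, eval_ofInt, hM.sum_zsmul,
    pow_nsmul_eval hinj hdiv g hz]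

theorem eval_nonneg [PartialOrder G] [IsOrderedAddMonoid G] (hG : IsUnperforated G) (hp : p ≠ 0)
    (hinj : ∀ x : G, p • x = 0 → x = 0) (hdiv : ∀ x : G, ∃ y : G, p • y = x) {g : Fin n → G}
    (hg : ∀ i, 0 ≤ g i) {x : StrictPow.{u} p n} (hx : ∀ i, 0 ≤ coord i x) :
    0 ≤ eval hinj hdiv g x := by
  obtain ⟨k, z, hz⟩ := exists_pow_nsmul_eq x
  refine hG (p ^ k) _ (by positivity) ?_
  rw [pow_nsmul_eval hinj hdiv g hz]
  refine Finset.sum_nonneg fun i _ => zsmul_nonneg (hg i) ?_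
  have h := congrArg (coord i) hz
  rw [map_nsmul, coord_ofInt] at h
  exact_mod_cast h ▸ nsmul_nonneg (hx i) (p ^ k)

end Eval

end StrictPow

/-! ### The filtered category of cells over `v`. -/

section Cells

variable {G : Type u} [AddCommGroup G] [PartialOrder G]

/-- An expression of `v` as a combination of finitely many positive elements with positive integer
coefficients; in other words, a positive homomorphism `ℤⁿ → G` with a strictly positive preimage of
`v`. -/
structure Cell (v : G) : Type u where
  /-- the number of elements -/
  n : ℕ
  /-- the elements -/
  gen : Fin n → G
  gen_nonneg : ∀ i, 0 ≤ gen i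
  /-- the coefficients -/
  mult : Fin n → ℕ
  mult_pos : ∀ i, 0 < mult i
  sum_eq : ∑ i, mult i • gen i = v

variable {v : G}

/-- `M` is a refinement of the generators of `c` that respects the coefficients. -/
structure Cell.IsHom (c d : Cell v) (M : Matrix (Fin d.n) (Fin c.n) ℕ) : Prop where
  refinement : IsRefinement c.gen d.gen M
  mulVec_mult : M.mulVec c.mult = d.mult

/-- A zero row would force a zero coefficient in `d`. This is what makes morphisms positive for the
strict orders. -/
theorem Cell.IsHom.exists_ne_zero {c d : Cell v} {M : Matrix (Fin d.n) (Fin c.n) ℕ}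
    (h : c.IsHom d M) (j : Fin d.n) : ∃ i, M j i ≠ 0 := by
  by_contra! hj
  have := congrFun h.mulVec_mult j
  rw [Matrix.mulVec, dotProduct, Finset.sum_eq_zero fun i _ => by rw [hj, zero_mul]] at this
  exact (d.mult_pos j).ne this

instance : SmallCategory (Cell v) where
  Hom c d := ULift.{u} {M : Matrix (Fin d.n) (Fin c.n) ℕ // c.IsHom d M}
  id c := ⟨1, .refl c.gen_nonneg, Matrix.one_mulVec _⟩
  comp f g := ⟨g.down.1 * f.down.1, f.down.2.refinement.trans g.down.2.refinement, by
    rw [← Matrix.mulVec_mulVec, f.down.2.mulVec_mult, g.down.2.mulVec_mult]⟩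
  id_comp f := ULift.down_injective (Subtype.ext (Matrix.mul_one _))
  comp_id f := ULift.down_injective (Subtype.ext (Matrix.one_mul _))
  assoc f g h := ULift.down_injective (Subtype.ext (Matrix.mul_assoc _ _ _).symm)

/-- The matrix of a morphism. -/
def Cell.mat {c d : Cell v} (f : c ⟶ d) : Matrix (Fin d.n) (Fin c.n) ℕ := f.down.1

theorem Cell.isHom_mat {c d : Cell v} (f : c ⟶ d) : c.IsHom d (Cell.mat f) := f.down.2

theorem Cell.mat_id (c : Cell v) : Cell.mat (𝟙 c) = 1 := rfl

theorem Cell.mat_comp {c d e : Cell v} (f : c ⟶ d) (g : d ⟶ e) :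
    Cell.mat (f ≫ g) = Cell.mat g * Cell.mat f := rfl

theorem Cell.hom_ext {c d : Cell v} {f g : c ⟶ d} (h : Cell.mat f = Cell.mat g) : f = g :=
  ULift.down_injective (Subtype.ext h)

/-- The morphism with a given matrix. -/
def Cell.IsHom.hom {c d : Cell v} {M : Matrix (Fin d.n) (Fin c.n) ℕ} (h : c.IsHom d M) : c ⟶ d :=
  ⟨M, h⟩

variable [IsOrderedAddMonoid G]

/-- Relations among positive elements with a distinguished combination equal to `v` become trivial
in a cell, as soon as the relations force every element into the face of that combination. -/
theorem exists_cell_annihilates (hG : IsDimensionGroup G) {ι : Type} [Fintype ι]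
    (g : ι → G) (hg : ∀ i, 0 ≤ g i) (c : ι → ℕ) (hc : ∑ i, c i • g i = v)
    (X : List (ι → ℤ)) (hX : ∀ x ∈ X, ∑ i, x i • g i = 0)
    (hface : ∀ r : ι → ℕ, (∀ x ∈ X, ∑ i, (r i : ℤ) * x i = 0) → (∀ i, r i * c i = 0) →
      ∀ i, r i = 0) :
    ∃ (d : Cell v) (M : Matrix (Fin d.n) ι ℕ),
      IsRefinement g d.gen M ∧ M.mulVec c = d.mult ∧ ∀ x ∈ X, Annihilates M x := by
  classical
  obtain ⟨κ, _, h, M, hM, hann⟩ := exists_refinement_annihilates_list hG g hg X hX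
  -- Cells need positive coefficients, so the generators with coefficient zero are discarded;
  -- `hface` shows that their rows vanish, so nothing is lost.
  let s := {j // M.mulVec c j ≠ 0}
  have hzero : ∀ j, ¬ M.mulVec c j ≠ 0 → ∀ i, M j i = 0 := fun j hj => by
    rw [not_not, Matrix.mulVec, dotProduct, Finset.sum_eq_zero_iff] at hj
    exact hface (M j) (fun x hx => hann x hx j) fun i => hj i (Finset.mem_univ i)
  let σ : Fin (Fintype.card s) ≃ s := (Fintype.equivFin s).symm
  have hsum : ∀ i, g i = ∑ j, M (σ j) i • h (σ j) := fun i => by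
    rw [hM.eq_sum i]
    refine (Fintype.sum_of_injective (fun j => (σ j).1)
      (Subtype.val_injective.comp σ.injective) _ _ (fun j hj => ?_) fun j => rfl).symm
    rw [hzero j (fun h => hj ⟨σ.symm ⟨j, h⟩, by simp⟩) i, zero_smul]
  have hd : ∑ j, M.mulVec c (σ j) • h (σ j) = v := by
    rw [← hc]
    simp_rw [hsum, Matrix.mulVec, dotProduct, Finset.sum_smul, Finset.smul_sum]
    rw [Finset.sum_comm]
    refine Finset.sum_congr rfl fun i _ => Finset.sum_congr rfl fun j _ => ?_
    rw [smul_smul, mul_comm]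
  exact ⟨⟨_, fun j => h (σ j), fun j => hM.nonneg _, fun j => M.mulVec c (σ j),
    fun j => Nat.pos_of_ne_zero (σ j).2, hd⟩, fun j => M (σ j), ⟨fun j => hM.nonneg _, hsum⟩, rfl,
    fun x hx j => hann x hx (σ j)⟩

theorem Cell.exists_hom_annihilates (hG : IsDimensionGroup G) (c : Cell v)
    (X : List (Fin c.n → ℤ)) (hX : ∀ x ∈ X, ∑ i, x i • c.gen i = 0) :
    ∃ (d : Cell v) (f : c ⟶ d), ∀ x ∈ X, Annihilates (Cell.mat f) x := by
  obtain ⟨d, M, h₁, h₂, h₃⟩ := exists_cell_annihilates hG c.gen c.gen_nonneg c.mult c.sum_eq X hX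
    fun r _ hr i => (Nat.mul_eq_zero.1 (hr i)).resolve_right (c.mult_pos i).ne'
  exact ⟨d, (Cell.IsHom.mk h₁ h₂).hom, h₃⟩

/-- As `x ≤ k • v`, the triple `v, x, k • v - x` satisfies a relation that forces a row vanishing on
`v` to vanish on the other two; its refinement is therefore a cell. -/
theorem Cell.exists_sum_eq (hG : IsDimensionGroup G) (hv : IsOrderUnit v) {x : G} (hx : 0 ≤ x) :
    ∃ (d : Cell v) (z : Fin d.n → ℕ), ∑ i, z i • d.gen i = x := by
  obtain ⟨k, hk⟩ := hv.2 x
  obtain ⟨d, M, h, -, -⟩ := exists_cell_annihilates (v := v) hG ![v, x, k • v - x]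
    (by simp [Fin.forall_fin_succ, hv.1, hx, hk]) ![1, 0, 0] (by simp [Fin.sum_univ_succ])
    [![k, -1, -1]] (by simp [Fin.sum_univ_succ]; abel) (by
      intro r hr h0
      simp [Fin.sum_univ_succ, Fin.forall_fin_succ] at hr h0 ⊢
      rw [h0] at hr
      push_cast at hr
      omega)
  exact ⟨d, fun j => M j 1, (h.eq_sum 1).symm⟩

theorem Cell.isFiltered (hG : IsDimensionGroup G) (hv : 0 ≤ v) : IsFiltered (Cell v) where
  nonempty := ⟨⟨1, fun _ => v, fun _ => hv, fun _ => 1, fun _ => one_pos, by simp⟩⟩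
  cocone_objs c d := by
    -- The generators of both cells are refined together, subject to the relation that the two
    -- expressions of `v` agree. Once it is trivial, the two halves of `M` send `c.mult` and
    -- `d.mult` to the same vector, so both are morphisms.
    obtain ⟨e, M, h₁, h₂, h₃⟩ := exists_cell_annihilates (v := v) hG (Sum.elim c.gen d.gen)
      (by rintro (i | i); exacts [c.gen_nonneg i, d.gen_nonneg i]) (Sum.elim c.mult 0)
      (by simp [c.sum_eq]) [Sum.elim (fun i => c.mult i) (fun i => -d.mult i)]
      (by simp [c.sum_eq, d.sum_eq]) (by
        intro r hr h0
        have hl : ∀ i, r (.inl i) = 0 := fun i =>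
          (Nat.mul_eq_zero.1 (h0 (.inl i))).resolve_right (c.mult_pos i).ne'
        have hr' : ∑ i, r (.inr i) * d.mult i = 0 := by
          simp only [List.mem_singleton, forall_eq, Fintype.sum_sum_type, hl,
            Sum.elim_inr, Nat.cast_zero, zero_mul, Finset.sum_const_zero, zero_add, mul_neg,
            Finset.sum_neg_distrib, neg_eq_zero] at hr
          exact_mod_cast hr
        rintro (i | i)
        · exact hl i
        · exact (Nat.mul_eq_zero.1 (Finset.sum_eq_zero_iff.1 hr' i (Finset.mem_univ i))).resolve_right
            (d.mult_pos i).ne')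
    have hsum : ∀ j, ∑ i, M j (.inl i) * c.mult i = ∑ i, M j (.inr i) * d.mult i := fun j => by
      have := h₃ _ (List.mem_singleton_self _) j
      simp at this
      zify
      linarith
    have hc : c.IsHom e fun j i => M j (.inl i) := ⟨⟨h₁.nonneg, fun i => h₁.eq_sum (.inl i)⟩, by
      rw [← h₂]
      ext j
      simp [Matrix.mulVec, dotProduct]⟩
    have hd : d.IsHom e fun j i => M j (.inr i) := ⟨⟨h₁.nonneg, fun i => h₁.eq_sum (.inr i)⟩, by
      rw [← h₂]
      ext j
      simp [Matrix.mulVec, dotProduct, hsum]⟩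
    exact ⟨e, hc.hom, hd.hom, trivial⟩
  cocone_maps c d f g := by
    -- The differences of corresponding columns of the two matrices are relations in `d`; killing
    -- them equalizes `f` and `g`.
    obtain ⟨e, h, he⟩ := d.exists_hom_annihilates hG
      (List.ofFn fun i j => (Cell.mat f j i : ℤ) - Cell.mat g j i) (by
        intro x hx
        obtain ⟨i, rfl⟩ := (List.mem_ofFn' _ _).1 hx
        simp_rw [sub_smul, Finset.sum_sub_distrib, natCast_zsmul]
        rw [← (Cell.isHom_mat f).refinement.eq_sum, ← (Cell.isHom_mat g).refinement.eq_sum,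
          sub_self])
    refine ⟨e, h, Cell.hom_ext ?_⟩
    ext k i
    have := he _ ((List.mem_ofFn' _ _).2 ⟨i, rfl⟩) k
    simp_rw [mul_sub, Finset.sum_sub_distrib] at this
    rw [Cell.mat_comp, Cell.mat_comp, Matrix.mul_apply, Matrix.mul_apply]
    zify
    linarith

end Cells

/-! ### The limit of the strictly ordered blocks is the simplification. -/

section Limit

variable {G : Type u} [AddCommGroup G] [PartialOrder G] {v : G}

/-- The system of groups `ℤ[1/p]ⁿ` with strict orders given by a directed system of cells. -/
def cellSystem (p : ℕ) {α : Type u} [PartialOrder α] [IsDirectedOrder α] [Nonempty α]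
    (F : α ⥤ Cell v) : PosSystem.{u} where
  Index := α
  obj i := StrictPow.{u} p (F.obj i).n
  map i j h := StrictPow.act (Cell.mat (F.map (homOfLE h)))
  map_nonneg i j h x hx := by
    rcases StrictPow.nonneg_iff.1 hx with rfl | hx
    · rw [map_zero]
    · exact StrictPow.nonneg_iff.2
        (Or.inr (StrictPow.coord_act_pos (Cell.isHom_mat _).exists_ne_zero hx))
  map_self i h x := by
    rw [Subsingleton.elim (homOfLE h) (𝟙 i), F.map_id, Cell.mat_id, StrictPow.act_one]
  map_map i j k hij hjk x := by
    rw [← StrictPow.act_mul, ← Cell.mat_comp, ← F.map_comp, homOfLE_comp]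

variable {p : ℕ} {α : Type u} [PartialOrder α] [IsDirectedOrder α] [Nonempty α]
  (F : α ⥤ Cell v)

/-- The preimage of `v` in a group of the system. -/
def cellUnit (p : ℕ) (c : Cell v) : StrictPow.{u} p c.n := StrictPow.ofInt fun i => c.mult i

theorem isOrderUnit_cellUnit (c : Cell v) : IsOrderUnit (cellUnit p c) :=
  StrictPow.isOrderUnit_iff.2 fun i => by
    rw [cellUnit, StrictPow.coord_ofInt]
    exact_mod_cast c.mult_pos i

theorem act_cellUnit {c d : Cell v} (f : c ⟶ d) :
    StrictPow.act (Cell.mat f) (cellUnit p c) = cellUnit p d := by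
  rw [cellUnit, StrictPow.act_ofInt, cellUnit, ← (Cell.isHom_mat f).mulVec_mult]
  congr 1
  ext j
  simp [Matrix.mulVec, dotProduct]

section Eval

variable (hinj : ∀ x : G, p • x = 0 → x = 0) (hdiv : ∀ x : G, ∃ y : G, p • y = x)

theorem eval_cellUnit (c : Cell v) : StrictPow.eval hinj hdiv c.gen (cellUnit p c) = v := by
  rw [cellUnit, StrictPow.eval_ofInt]
  simp_rw [natCast_zsmul]
  exact c.sum_eq

/-- The canonical homomorphism from the limit of the system to `G`. -/
noncomputable def cellLift : (cellSystem p F).Limit →+ G :=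
  letI := Classical.decEq (cellSystem p F).Index
  AddCommGroup.DirectLimit.lift _ _ G (fun i : α => StrictPow.eval hinj hdiv (F.obj i).gen)
    fun _ _ _ x => StrictPow.eval_act hinj hdiv (Cell.isHom_mat _).refinement x

theorem cellLift_toLimit (i : α) (x : StrictPow.{u} p (F.obj i).n) :
    cellLift F hinj hdiv ((cellSystem p F).toLimit i x) =
      StrictPow.eval hinj hdiv (F.obj i).gen x :=
  let := Classical.decEq (cellSystem p F).Index
  AddCommGroup.DirectLimit.lift_of _ _ _ _ _

end Eval

theorem toLimit_map (S : PosSystem.{u}) {i j : S.Index} (h : i ≤ j) (x : S.obj i) :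
    S.toLimit j (S.map i j h x) = S.toLimit i x :=
  let := Classical.decEq S.Index
  AddCommGroup.DirectLimit.of_f _ _

theorem toLimit_eq_zero (S : PosSystem.{u}) {i j : S.Index} (h : i ≤ j) {x : S.obj i}
    (hx : S.map i j h x = 0) : S.toLimit i x = 0 := by
  rw [← toLimit_map S h, hx, map_zero]

theorem exists_toLimit_eq (S : PosSystem.{u}) (z : S.Limit) : ∃ i x, S.toLimit i x = z := by
  let := Classical.decEq S.Index
  induction z using AddCommGroup.DirectLimit.induction_on with
  | ih i x => exact ⟨i, x, rfl⟩

variable [IsOrderedAddMonoid G]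

/-- After clearing denominators, an element of the kernel is an integer relation, which some
morphism of cells kills; finality of `F` moves this morphism into the directed system. -/
theorem exists_act_eq_zero (hG : IsDimensionGroup G) (hp : p ≠ 0)
    (hinj : ∀ x : G, p • x = 0 → x = 0) (hdiv : ∀ x : G, ∃ y : G, p • y = x) [F.Final] (i : α)
    {x : StrictPow.{u} p (F.obj i).n} (hx : StrictPow.eval hinj hdiv (F.obj i).gen x = 0) :
    ∃ (j : α) (f : i ⟶ j), StrictPow.act (Cell.mat (F.map f)) x = 0 := by
  obtain ⟨k, z, hz⟩ := StrictPow.exists_pow_nsmul_eq x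
  obtain ⟨d, f, hf⟩ := (F.obj i).exists_hom_annihilates hG [z] (by
    rintro y hy
    rw [List.mem_singleton.1 hy, ← StrictPow.pow_nsmul_eval hinj hdiv _ hz, hx, smul_zero])
  have hfx : StrictPow.act (Cell.mat f) x = 0 := by
    refine StrictPow.ext fun j => ?_
    have h := congrArg (StrictPow.coord j ∘ StrictPow.act (Cell.mat f)) hz
    have h₀ := hf z (List.mem_singleton_self z) j
    simp only [Function.comp_apply, map_nsmul, StrictPow.act_ofInt, StrictPow.coord_ofInt, h₀,
      Int.cast_zero, nsmul_eq_mul, Nat.cast_pow] at h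
    rw [map_zero]
    exact (mul_eq_zero.1 h).resolve_left (by positivity)
  obtain ⟨hF₁, hF₂⟩ := F.final_iff_of_isFiltered.1 inferInstance
  obtain ⟨j, ⟨g⟩⟩ := hF₁ d
  obtain ⟨k, hik, hjk⟩ := exists_ge_ge i j
  -- The route through `d` need not agree with the connecting map of the system, so the two are
  -- equalized at a later stage.
  obtain ⟨l, t, ht⟩ := hF₂ (F.map (homOfLE hik)) (f ≫ g ≫ F.map (homOfLE hjk))
  refine ⟨l, homOfLE hik ≫ t, ?_⟩
  rw [F.map_comp, ht, Category.assoc, Cell.mat_comp, StrictPow.act_mul, hfx, map_zero]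

theorem exists_eval_eq (hG : IsDimensionGroup G) (hv : IsOrderUnit v)
    (hinj : ∀ x : G, p • x = 0 → x = 0) (hdiv : ∀ x : G, ∃ y : G, p • y = x) [F.Final] {x : G}
    (hx : 0 ≤ x) : ∃ (i : α) (a : StrictPow.{u} p (F.obj i).n),
      (∀ k, 0 ≤ StrictPow.coord k a) ∧ StrictPow.eval hinj hdiv (F.obj i).gen a = x := by
  obtain ⟨d, z, hz⟩ := Cell.exists_sum_eq hG hv hx
  obtain ⟨i, ⟨f⟩⟩ := (F.final_iff_of_isFiltered.1 inferInstance).1 d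
  refine ⟨i, StrictPow.act (Cell.mat f) (StrictPow.ofInt fun k => z k),
    StrictPow.coord_act_nonneg _ fun k => by simp, ?_⟩
  rw [StrictPow.eval_act hinj hdiv (Cell.isHom_mat f).refinement, StrictPow.eval_ofInt, ← hz]
  simp_rw [natCast_zsmul]

/-- An order unit of `G` lifts to an element with positive coordinates. -/
theorem exists_eval_eq_of_isOrderUnit (hG : IsDimensionGroup G) (hv : IsOrderUnit v) (hp : p ≠ 0)
    (hinj : ∀ x : G, p • x = 0 → x = 0) (hdiv : ∀ x : G, ∃ y : G, p • y = x) [F.Final] {x : G}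
    (hx : IsOrderUnit x) : ∃ (i : α) (a : StrictPow.{u} p (F.obj i).n),
      (∀ k, 0 < StrictPow.coord k a) ∧ StrictPow.eval hinj hdiv (F.obj i).gen a = x := by
  obtain ⟨N, hN⟩ := hx.2 v
  obtain ⟨i, a, ha, hax⟩ := exists_eval_eq F hG hv hinj hdiv hx.1
  obtain ⟨j, b, hb, hbx⟩ := exists_eval_eq F hG hv hinj hdiv (sub_nonneg.2 hN)
  obtain ⟨k, hik, hjk⟩ := exists_ge_ge i j
  let f := F.map (homOfLE hik)
  let g := F.map (homOfLE hjk)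
  -- With `a` over `x` and `b` over `N • x - v`, the identity `N • a = b + cellUnit` holds at a late
  -- stage. There `b` is coordinatewise nonnegative and `cellUnit` strictly positive, so `a` is
  -- strictly positive.
  obtain ⟨l, t, ht⟩ := exists_act_eq_zero F hG hp hinj hdiv k
    (x := N • StrictPow.act (Cell.mat f) a - StrictPow.act (Cell.mat g) b - cellUnit p _) (by
      rw [map_sub, map_sub, map_nsmul, StrictPow.eval_act hinj hdiv (Cell.isHom_mat f).refinement,
        StrictPow.eval_act hinj hdiv (Cell.isHom_mat g).refinement, eval_cellUnit, hax, hbx]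
      abel)
  refine ⟨l, StrictPow.act (Cell.mat (F.map t)) (StrictPow.act (Cell.mat f) a), fun m => ?_, ?_⟩
  · have h := congrArg (StrictPow.coord m) ht
    simp only [map_sub, map_nsmul, act_cellUnit, map_zero] at h
    rw [sub_sub, sub_eq_zero, nsmul_eq_mul] at h
    have h₁ := StrictPow.coord_act_nonneg (Cell.mat (F.map t))
      (StrictPow.coord_act_nonneg (Cell.mat g) hb) m
    have h₂ := StrictPow.isOrderUnit_iff.1 (isOrderUnit_cellUnit (p := p) (F.obj l)) m
    exact pos_of_mul_pos_right (h ▸ add_pos_of_nonneg_of_pos h₁ h₂) (Nat.cast_nonneg N)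
  · rw [StrictPow.eval_act hinj hdiv (Cell.isHom_mat _).refinement,
      StrictPow.eval_act hinj hdiv (Cell.isHom_mat f).refinement, hax]

/-- A multiple of `a` dominates `cellUnit`, so a multiple of its image dominates `v`. -/
theorem isOrderUnit_eval (hG : IsDimensionGroup G) (hv : IsOrderUnit v) (hp : p ≠ 0)
    (hinj : ∀ x : G, p • x = 0 → x = 0) (hdiv : ∀ x : G, ∃ y : G, p • y = x) (c : Cell v)
    {a : StrictPow.{u} p c.n} (ha : ∀ k, 0 < StrictPow.coord k a) :
    IsOrderUnit (StrictPow.eval hinj hdiv c.gen a) := by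
  refine ⟨StrictPow.eval_nonneg hG.unperforated hp hinj hdiv c.gen_nonneg fun k => (ha k).le,
    fun x => ?_⟩
  obtain ⟨m, hm⟩ := hv.2 x
  obtain ⟨N, hN⟩ := (StrictPow.isOrderUnit_of_coord_pos ha).2 (cellUnit p c)
  have h := StrictPow.eval_nonneg hG.unperforated hp hinj hdiv c.gen_nonneg
    (StrictPow.coord_nonneg (sub_nonneg.2 hN))
  rw [map_sub, map_nsmul, eval_cellUnit, sub_nonneg] at h
  exact ⟨m * N, hm.trans (by rw [mul_nsmul']; exact nsmul_le_nsmul_right h m)⟩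

theorem cellLift_bijective (hG : IsDimensionGroup G) (hv : IsOrderUnit v) (hp : p ≠ 0)
    (hinj : ∀ x : G, p • x = 0 → x = 0) (hdiv : ∀ x : G, ∃ y : G, p • y = x) [F.Final] :
    Function.Bijective (cellLift F hinj hdiv) := by
  refine ⟨(injective_iff_map_eq_zero _).2 fun z hz => ?_, fun x => ?_⟩
  · obtain ⟨i, a, rfl⟩ := exists_toLimit_eq _ z
    obtain ⟨j, f, hf⟩ := exists_act_eq_zero F hG hp hinj hdiv i
      ((cellLift_toLimit F hinj hdiv i a).symm.trans hz)
    exact toLimit_eq_zero (cellSystem p F) (leOfHom f) hf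
  -- Only positive elements are known to lift, so `x + N • v` is lifted and `N` copies of the
  -- preimage of `v` are subtracted.
  · obtain ⟨N, hN⟩ := hv.2 (-x)
    obtain ⟨i, a, -, ha⟩ := exists_eval_eq F hG hv hinj hdiv (neg_le_iff_add_nonneg.1 hN)
    refine ⟨(cellSystem p F).toLimit i (a - N • cellUnit p (F.obj i)), ?_⟩
    refine (cellLift_toLimit F hinj hdiv i _).trans ?_
    rw [map_sub, map_nsmul, ha, eval_cellUnit, add_sub_cancel_left]

/-- The limit of the system of cells is the simplification. -/
theorem hasLimit_cellSystem (hG : IsDimensionGroup G) (hv : IsOrderUnit v) (hp : p ≠ 0)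
    (hinj : ∀ x : G, p • x = 0 → x = 0) (hdiv : ∀ x : G, ∃ y : G, p • y = x) [F.Final] :
    (cellSystem p F).HasLimit (Simplification G) := by
  have hbij := cellLift_bijective F hG hv hp hinj hdiv
  refine ⟨(AddEquiv.ofBijective _ hbij).trans (Simplification.equiv G), fun z => ?_⟩
  change 0 ≤ Simplification.equiv G (cellLift F hinj hdiv z) ↔ _
  rw [Simplification.nonneg_iff]
  constructor
  · rintro (h | h)
    · have hz : z = 0 := hbij.1 (h.trans (map_zero _).symm)
      exact ⟨Classical.arbitrary (cellSystem p F).Index, 0, le_rfl, by rw [map_zero, hz]⟩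
    · obtain ⟨i, a, ha, haz⟩ := exists_eval_eq_of_isOrderUnit F hG hv hp hinj hdiv h
      exact ⟨i, a, StrictPow.nonneg_iff.2 (Or.inr ha),
        hbij.1 ((cellLift_toLimit F hinj hdiv i a).trans haz)⟩
  · rintro ⟨i, a, ha, rfl⟩
    have h := cellLift_toLimit F hinj hdiv i a
    rcases StrictPow.nonneg_iff.1 ha with ha | ha
    · exact Or.inl (h.trans ((congrArg _ ha).trans (map_zero _)))
    · exact Or.inr (h ▸ isOrderUnit_eval hG hv hp hinj hdiv (F.obj i) ha)

/-- The simplification of a `p`-divisible dimension group with order unit is a limit of simple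
approximately divisible dimension groups with finitely many pure traces, along maps that respect
order units. -/
theorem exists_system_hasLimit_simplification (hG : IsDimensionGroup G) (hv : IsOrderUnit v)
    (hp : 1 < p) (hdiv : ∀ x : G, ∃ y : G, p • y = x) :
    ∃ (S : PosSystem.{u}) (w : ∀ i, S.obj i), S.HasLimit (Simplification G) ∧
      (∀ i, IsDimensionGroup (S.obj i) ∧ IsSimple (S.obj i) ∧
        HasFinitelyManyPureTraces (S.obj i) ∧ IsApproximatelyDivisible (S.obj i) ∧
        IsOrderUnit (w i)) ∧
      ∀ i j (h : i ≤ j), IsOrderUnit (S.map i j h (w i)) := by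
  have hp₀ : p ≠ 0 := by omega
  have hinj : ∀ x : G, p • x = 0 → x = 0 := fun x hx => le_antisymm
    (neg_nonneg.1 (hG.unperforated p _ (by omega) (by rw [smul_neg, hx, neg_zero])))
    (hG.unperforated p _ (by omega) hx.ge)
  have := Cell.isFiltered hG hv.1
  -- Cells form a filtered category, not a directed set; a final functor from a directed poset gives
  -- an admissible index set.
  obtain ⟨α, _, _, _, F, _⟩ := IsFiltered.exists_directed (Cell v)
  refine ⟨cellSystem p F, fun i => cellUnit p (F.obj i), hasLimit_cellSystem F hG hv hp₀ hinj hdiv,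
    fun i => ⟨StrictPow.isDimensionGroup hp, StrictPow.isSimple,
      StrictPow.hasFinitelyManyPureTraces hp₀, StrictPow.isApproximatelyDivisible hp,
      isOrderUnit_cellUnit _⟩, fun i j h => ?_⟩
  exact (act_cellUnit (p := p) (F.map (homOfLE h))).symm ▸ isOrderUnit_cellUnit _

end Limit

/-! ### Simple groups coincide with their simplifications. -/

section Simple

variable {G : Type u} [AddCommGroup G] [PartialOrder G] [IsOrderedAddMonoid G]

/-- In a simple group every nonzero positive element is an order unit. -/
theorem IsSimple.isOrderUnit (hG : IsSimple G) {v : G} (hv : 0 ≤ v)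
    (hv₀ : v ≠ 0) : IsOrderUnit v := by
  -- The order ideal generated by `v`.
  let H : AddSubgroup G :=
    { carrier := {x | ∃ n : ℕ, -(n • v) ≤ x ∧ x ≤ n • v}
      zero_mem' := ⟨0, by simp⟩
      add_mem' := by
        rintro a b ⟨n, h₁, h₂⟩ ⟨m, h₃, h₄⟩
        refine ⟨n + m, ?_, ?_⟩
        · rw [add_nsmul, neg_add]
          exact add_le_add h₁ h₃
        · rw [add_nsmul]
          exact add_le_add h₂ h₄
      neg_mem' := by
        rintro a ⟨n, h₁, h₂⟩
        exact ⟨n, neg_le_neg h₂, neg_le.1 h₁⟩ }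
  have hmem : ∀ n : ℕ, n • v ∈ H := fun n =>
    ⟨n, (neg_nonpos.2 (nsmul_nonneg hv n)).trans (nsmul_nonneg hv n), le_rfl⟩
  have hmono : ∀ n m : ℕ, n • v ≤ (n + m) • v := fun n m => by
    rw [add_nsmul]
    exact le_add_of_nonneg_right (nsmul_nonneg hv m)
  have hH : IsOrderIdeal H := by
    refine ⟨⟨?_⟩, ?_⟩
    · rintro a ⟨n, h₁, -⟩ b ⟨m, -, h₂⟩ x ⟨hax, hxb⟩
      exact ⟨n + m, (neg_le_neg (hmono n m)).trans (h₁.trans hax),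
        hxb.trans (h₂.trans (add_comm m n ▸ hmono m n))⟩
    · rintro a ⟨n, -, h₁⟩ b ⟨m, -, h₂⟩
      exact ⟨_, hmem (n + m), h₁.trans (hmono n m), h₂.trans (add_comm m n ▸ hmono m n)⟩
  rcases hG H hH with h | h
  · exact absurd ((AddSubgroup.eq_bot_iff_forall H).1 h v (by simpa using hmem 1)) hv₀
  · refine ⟨hv, fun x => ?_⟩
    obtain ⟨n, -, hn⟩ : x ∈ H := h ▸ AddSubgroup.mem_top x
    exact ⟨n, hn⟩

theorem IsSimple.exists_isOrderUnit (hG : IsSimple G) (hdir : IsDirectedOrder G) :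
    ∃ v : G, IsOrderUnit v := by
  by_cases h : ∃ v : G, 0 ≤ v ∧ v ≠ 0
  · obtain ⟨v, hv, hv₀⟩ := h
    exact ⟨v, hG.isOrderUnit hv hv₀⟩
  · push Not at h
    -- With no nonzero positive element, directedness puts every `x` below `0`, so `0` is an order
    -- unit.
    refine ⟨0, le_rfl, fun x => ⟨0, ?_⟩⟩
    obtain ⟨y, h₁, h₂⟩ := exists_ge_ge x 0
    rw [zero_smul]
    exact h y h₂ ▸ h₁

/-- A simple group is its own simplification. -/
theorem IsSimple.hasLimit_of_simplification (hG : IsSimple G)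
    {S : PosSystem.{u}} (hS : S.HasLimit (Simplification G)) : S.HasLimit G := by
  obtain ⟨e, he⟩ := hS
  refine ⟨e.trans (Simplification.equiv G).symm, fun z => ?_⟩
  rw [← he z, AddEquiv.trans_apply]
  obtain ⟨x, hx⟩ := (Simplification.equiv G).surjective (e z)
  rw [← hx, AddEquiv.symm_apply_apply, Simplification.nonneg_iff]
  refine ⟨fun h => or_iff_not_imp_left.2 (hG.isOrderUnit h), ?_⟩
  rintro (rfl | h)
  · exact le_rfl
  · exact h.1

end Simple

end OrderedGroup

theorem corollary1p4 {G : Type*} [AddCommGroup G] [PartialOrder G] [IsOrderedAddMonoid G]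
    (hG : OrderedGroup.IsDimensionGroup G) (p : ℕ) (hp : 1 < p)
    (hdiv : ∀ x : G, ∃ y : G, p • y = x) :
    ((∃ v : G, OrderedGroup.IsOrderUnit v) →
      OrderedGroup.IsLimitOfSimpleFD (OrderedGroup.Simplification G)) ∧
    (OrderedGroup.IsSimple G →
      OrderedGroup.IsLimitOfSimpleFD G ∧ OrderedGroup.IsProFD G) := by
  constructor
  · rintro ⟨v, hv⟩
    obtain ⟨S, _, hS, h, _⟩ :=
      OrderedGroup.exists_system_hasLimit_simplification hG hv hp hdiv
    exact ⟨S, hS, fun i => ⟨(h i).1, (h i).2.1, (h i).2.2.1⟩⟩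
  · intro hs
    obtain ⟨v, hv⟩ := hs.exists_isOrderUnit hG.directed
    obtain ⟨S, w, hS, h, hw⟩ :=
      OrderedGroup.exists_system_hasLimit_simplification hG hv hp hdiv
    have hS' := hs.hasLimit_of_simplification hS
    exact ⟨⟨S, hS', fun i => ⟨(h i).1, (h i).2.1, (h i).2.2.1⟩⟩, hG, S, w, hS',
      fun i => ⟨(h i).1, (h i).2.2.2.1, (h i).2.2.2.2, (h i).2.2.1.2 _ (h i).2.2.2.2⟩, hw⟩
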